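/- For an integer $n\ge 2$ let $G_n=\langle x,y : x^{4n}=y^2=1,\ yxy=x^{2n-1}\rangle = C_{4n}\rtimes_{2n-1}C_2$ be the generalized quasi-dihedral group of order $8n$. For a closed (compact, connected) Riemann surface $S$ let $\mathrm{Aut}(S)$ be its group of conformal and anticonformal automorphisms and $\mathrm{Aut}^+(S)$ its subgroup of conformal automorphisms; $S$ is called pseudo-real if it has anticonformal automorphisms but no anticonformal automorphism of order two. Let $n\ge 2$ be even. Then there is no pseudo-real Riemann surface $S$ such that $\mathrm{Aut}^+(S)$ has a subgroup $H\cong G_n$ and some $\alpha\in\mathrm{Aut}(S)\setminus\mathrm{Aut}^+(S)$ satisfies $\alpha H\alpha^{-1}=H$ and $\alpha^2\in H$ (equivalently, $H$ has index two in $\langle H,\alpha\rangle$). In particular, there is no pseudo-real Riemann surface $S$ with $\mathrm{Aut}^+(S)\cong G_n$. -/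

import Mathlib

open scoped Manifold ContDiff ComplexConjugate

namespace QuasiDihedral

/-- Multiplication by `2n - 1` on `ℤ/4n`, as an automorphism of the cyclic group `C_{4n}`;
it is its own inverse since `(2n - 1)² = 4n(n - 1) + 1`. -/
def twist (n : ℕ) : MulAut (Multiplicative (ZMod (4 * n))) :=
  have h : ∀ a : ZMod (4 * n), (2 * (n : ZMod (4 * n)) - 1) * ((2 * n - 1) * a) = a := by
    intro a
    have h4 : (4 : ZMod (4 * n)) * n = 0 := by
      have := ZMod.natCast_self (4 * n)
      push_cast at this
      exact this
    linear_combination (n - 1 : ZMod (4 * n)) * a * h4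
  AddEquiv.toMultiplicative
    { toFun := fun a => (2 * (n : ZMod (4 * n)) - 1) * a
      invFun := fun a => (2 * (n : ZMod (4 * n)) - 1) * a
      left_inv := h
      right_inv := h
      map_add' := fun a b => mul_add _ a b }

theorem twist_mul_twist (n : ℕ) : twist n * twist n = 1 := by
  ext a
  exact (twist n).symm_apply_apply a

/-- The action of `C₂` on `C_{4n}` in which the generator acts by `x ↦ x^{2n-1}`. -/
def action (n : ℕ) : Multiplicative (ZMod 2) →* MulAut (Multiplicative (ZMod (4 * n))) where
  toFun e := if e = 1 then 1 else twist n
  map_one' := by simp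
  map_mul' := by
    have key : ∀ a b : Multiplicative (ZMod 2),
        (a = 1 ∧ a * b = b) ∨ (b = 1 ∧ a * b = a) ∨ (a ≠ 1 ∧ b ≠ 1 ∧ a * b = 1) := by
      decide
    intro a b
    rcases key a b with ⟨h1, h2⟩ | ⟨h1, h2⟩ | ⟨h1, h2, h3⟩
    · rw [h2, if_pos h1, one_mul]
    · rw [h2, if_pos h1, mul_one]
    · rw [h3, if_pos rfl, if_neg h1, if_neg h2, twist_mul_twist]

/-- The generalized quasi-dihedral group of order `8n`,
`⟨x, y : x^{4n} = y² = 1, y x y = x^{2n-1}⟩ = C_{4n} ⋊_{2n-1} C₂`. -/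
abbrev G (n : ℕ) : Type :=
  Multiplicative (ZMod (4 * n)) ⋊[action n] Multiplicative (ZMod 2)

end QuasiDihedral

namespace RiemannSurface

universe u

variable {S : Type u} [TopologicalSpace S] [ChartedSpace ℂ S]

/-- The map `f` read in the preferred charts at `p` and `f p`. -/
noncomputable def localRep (f : S → S) (p : S) : ℂ → ℂ :=
  chartAt ℂ (f p) ∘ f ∘ (chartAt ℂ p).symm

/-- `f` is holomorphic: continuous, and complex differentiable when read in charts. -/
def IsHolomorphic (f : S → S) : Prop :=
  Continuous f ∧ ∀ p, DifferentiableAt ℂ (localRep f p) (chartAt ℂ p p)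

/-- `f` is antiholomorphic: continuous, and the complex conjugate of its expression in charts is
complex differentiable. -/
def IsAntiholomorphic (f : S → S) : Prop :=
  Continuous f ∧ ∀ p, DifferentiableAt ℂ (conj ∘ localRep f p) (chartAt ℂ p p)

/-- The notion of a holomorphic map used here is Mathlib's. -/
theorem isHolomorphic_iff_mdifferentiable (f : S → S) :
    IsHolomorphic f ↔ MDifferentiable 𝓘(ℂ) 𝓘(ℂ) f := by
  have h : ∀ p, MDifferentiableAt 𝓘(ℂ) 𝓘(ℂ) f p ↔
      ContinuousAt f p ∧ DifferentiableAt ℂ (localRep f p) (chartAt ℂ p p) := by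
    intro p
    rw [mdifferentiableAt_iff]
    simp [writtenInExtChartAt, localRep, extChartAt, differentiableWithinAt_univ]
  simp only [IsHolomorphic, MDifferentiable, h, forall_and, continuous_iff_continuousAt]

theorem localRep_apply_self (f : S → S) (p : S) :
    localRep f p (chartAt ℂ p p) = chartAt ℂ (f p) (f p) := by
  simp [localRep]

theorem localRep_comp (g : S → S) {f : S → S} (hf : Continuous f) (p : S) :
    localRep (g ∘ f) p =ᶠ[nhds (chartAt ℂ p p)] localRep g (f p) ∘ localRep f p := by
  have hc : ContinuousAt (f ∘ (chartAt ℂ p).symm) (chartAt ℂ p p) :=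
    hf.continuousAt.comp
      ((chartAt ℂ p).continuousAt_symm (mem_chart_target ℂ p))
  have hs : (chartAt ℂ (f p)).source ∈ nhds ((f ∘ (chartAt ℂ p).symm) (chartAt ℂ p p)) := by
    simpa using chart_source_mem_nhds ℂ (f p)
  filter_upwards [hc hs] with z hz
  have hz' : f ((chartAt ℂ p).symm z) ∈ (chartAt ℂ (f p)).source := hz
  simp [localRep, (chartAt ℂ (f p)).left_inv hz']

theorem localRep_id (p : S) : localRep (id : S → S) p =ᶠ[nhds (chartAt ℂ p p)] id := by
  filter_upwards [(chartAt ℂ p).open_target.mem_nhds (mem_chart_target ℂ p)] with z hz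
  simp [localRep, (chartAt ℂ p).right_inv hz]

theorem isHolomorphic_id : IsHolomorphic (id : S → S) :=
  ⟨continuous_id, fun p => differentiableAt_id.congr_of_eventuallyEq (localRep_id p)⟩

theorem IsHolomorphic.comp {g f : S → S} (hg : IsHolomorphic g) (hf : IsHolomorphic f) :
    IsHolomorphic (g ∘ f) := by
  refine ⟨hg.1.comp hf.1, fun p => ?_⟩
  refine DifferentiableAt.congr_of_eventuallyEq ?_ (localRep_comp g hf.1 p)
  refine DifferentiableAt.comp _ ?_ (hf.2 p)
  rw [localRep_apply_self]
  exact hg.2 (f p)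

theorem IsAntiholomorphic.comp_isHolomorphic {g f : S → S} (hg : IsAntiholomorphic g)
    (hf : IsHolomorphic f) : IsAntiholomorphic (g ∘ f) := by
  refine ⟨hg.1.comp hf.1, fun p => ?_⟩
  refine DifferentiableAt.congr_of_eventuallyEq ?_ ((localRep_comp g hf.1 p).fun_comp conj)
  refine DifferentiableAt.comp (g := conj ∘ localRep g (f p)) _ ?_ (hf.2 p)
  rw [localRep_apply_self]
  exact hg.2 (f p)

theorem IsHolomorphic.comp_isAntiholomorphic {g f : S → S} (hg : IsHolomorphic g)
    (hf : IsAntiholomorphic f) : IsAntiholomorphic (g ∘ f) := by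
  refine ⟨hg.1.comp hf.1, fun p => ?_⟩
  refine DifferentiableAt.congr_of_eventuallyEq ?_ ((localRep_comp g hf.1 p).fun_comp conj)
  have h1 : DifferentiableAt ℂ (conj ∘ localRep g (f p) ∘ conj)
      ((conj ∘ localRep f p) (chartAt ℂ p p)) := by
    simp only [Function.comp_apply, localRep_apply_self]
    exact (hg.2 (f p)).conj_conj
  have h2 := DifferentiableAt.comp _ h1 (hf.2 p)
  refine h2.congr_of_eventuallyEq (Filter.Eventually.of_forall fun z => ?_)
  simp

theorem IsAntiholomorphic.comp {g f : S → S} (hg : IsAntiholomorphic g)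
    (hf : IsAntiholomorphic f) : IsHolomorphic (g ∘ f) := by
  refine ⟨hg.1.comp hf.1, fun p => ?_⟩
  refine DifferentiableAt.congr_of_eventuallyEq ?_ (localRep_comp g hf.1 p)
  have h1 : DifferentiableAt ℂ (conj ∘ (conj ∘ localRep g (f p)) ∘ conj)
      ((conj ∘ localRep f p) (chartAt ℂ p p)) := by
    simp only [Function.comp_apply, localRep_apply_self]
    exact (hg.2 (f p)).conj_conj
  have h2 := DifferentiableAt.comp _ h1 (hf.2 p)
  refine h2.congr_of_eventuallyEq (Filter.Eventually.of_forall fun z => ?_)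
  simp

/-- A conformal automorphism: a biholomorphic self-map. -/
def IsConformal (f : S ≃ₜ S) : Prop := IsHolomorphic f ∧ IsHolomorphic f.symm

/-- An anticonformal automorphism: an antiholomorphic self-map with antiholomorphic inverse. -/
def IsAnticonformal (f : S ≃ₜ S) : Prop := IsAntiholomorphic f ∧ IsAntiholomorphic f.symm

variable (S)

/-- `Aut⁺(S)`, the group of conformal automorphisms of `S`. -/
def AutPlus : Subgroup (S ≃ₜ S) where
  carrier := {f | IsConformal f}
  one_mem' := ⟨isHolomorphic_id, isHolomorphic_id⟩
  mul_mem' := fun ha hb => ⟨ha.1.comp hb.1, hb.2.comp ha.2⟩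
  inv_mem' := fun ha => ⟨ha.2, ha.1⟩

/-- `Aut(S)`, the group of conformal and anticonformal automorphisms of `S`. -/
def Aut : Subgroup (S ≃ₜ S) where
  carrier := {f | IsConformal f ∨ IsAnticonformal f}
  one_mem' := Or.inl ⟨isHolomorphic_id, isHolomorphic_id⟩
  mul_mem' := by
    rintro a b (ha | ha) (hb | hb)
    · exact Or.inl ⟨ha.1.comp hb.1, hb.2.comp ha.2⟩
    · exact Or.inr ⟨ha.1.comp_isAntiholomorphic hb.1, hb.2.comp_isHolomorphic ha.2⟩
    · exact Or.inr ⟨ha.1.comp_isHolomorphic hb.1, hb.2.comp_isAntiholomorphic ha.2⟩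
    · exact Or.inl ⟨ha.1.comp hb.1, hb.2.comp ha.2⟩
  inv_mem' := by
    rintro a (ha | ha)
    · exact Or.inl ⟨ha.2, ha.1⟩
    · exact Or.inr ⟨ha.2, ha.1⟩

/-- `S` is pseudo-real: it has anticonformal automorphisms, but no anticonformal involution. -/
def IsPseudoReal : Prop :=
  (∃ f : S ≃ₜ S, IsAnticonformal f) ∧ ∀ f : S ≃ₜ S, IsAnticonformal f → orderOf f ≠ 2

end RiemannSurface

namespace QuasiDihedral

/-! The obstruction is purely group-theoretic: for even `n`, every coset `Hα` with `H ≅ G n`, `α`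
normalizing `H` and `α ^ 2 ∈ H` contains an element of trivial square. If `H` is conformal and `α`
anticonformal, this element is an anticonformal involution. Conjugation by `α` sends `x` to `x ^ u`
and `y` to `x ^ (2k) y`, and parity of `n` forces `α ^ 2 = x ^ m`; `exists_involution_exponent` then
finds `a` such that `x ^ a α` or `x ^ a y α` squares to `1`, according to `u` mod 4. -/

/-- The congruences satisfied by the exponents of an automorphism `x ↦ x ^ u`, `y ↦ x ^ (2k) y` whose
square is conjugation by `x ^ m` allow one to solve one of the two equations expressing that a coset
representative is an involution. -/
theorem exists_involution_exponent {n u k m : ℤ} (hev : Even n) (hu : 4 * n ∣ u ^ 2 - 1)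
    (hk : 4 * n ∣ 2 * k * (u + 1) - m * (2 - 2 * n)) :
    ∃ a : ℤ, 4 * n ∣ a * (1 + u) + m ∨
      4 * n ∣ a + (2 * n - 1) * (u * a + 2 * k) + m := by
  obtain ⟨N, rfl⟩ := hev
  obtain ⟨q, hq⟩ := hk
  have hodd : Odd u := by
    rw [← Int.not_even_iff_odd]
    rintro ⟨v, rfl⟩
    obtain ⟨r, hr⟩ := hu
    have : 4 * (v * v) - 8 * (N * r) = 1 := by linear_combination hr
    omega
  -- Halve `hq` and multiply by `1 - n`, which is its own inverse modulo `2n` because `n` is even.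
  obtain ⟨e, he⟩ : ∃ e : ℤ, m = k * (u + 1) * (1 - (N + N)) + 2 * (N + N) * e := by
    refine ⟨-q * (1 - (N + N)) - (N - 1) * m, ?_⟩
    have h2 : k * (u + 1) - m * (1 - (N + N)) = 2 * (N + N) * q := by linarith
    linear_combination (-(1 - (N + N))) * h2
  obtain ⟨w, hw⟩ := hodd
  rcases Int.even_or_odd' w with ⟨c, rfl | rfl⟩
  -- Here `u ≡ 1` mod 4: the `k` terms cancel, leaving `n e (u + 3)`.
  · refine ⟨-k * (1 - (N + N)) + (N + N) * e, Or.inl ⟨e * (c + 1), ?_⟩⟩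
    subst he hw
    ring
  -- Here `u ≡ 3` mod 4: `a = k` leaves a residue `2nT` modulo `4n`, with `T = k(2c + 1) + e`;
  -- adding `nT` to `a` cancels it.
  · refine ⟨k + (N + N) * (k * (2 * c + 1) + e),
      Or.inr ⟨(k * (2 * c + 1) + e) * (N * u - c) + k, ?_⟩⟩
    subst he hw
    ring

/-! ### Extensions of the quasi-dihedral group by a group of order two -/

variable {Γ : Type*} [Group Γ]

theorem mul_zpow_eq_of_conj {x y : Γ} {t : ℤ} (h : y * x * y⁻¹ = x ^ t) (i : ℤ) :
    y * x ^ i = x ^ (t * i) * y := by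
  rw [zpow_mul, ← h, conj_zpow, inv_mul_cancel_right]

/-- If `H = ⟨x, y⟩` is generalized quasi-dihedral of order `8n` with `n` even, then every coset `Hα`
with `α` normalizing `H` and `α ^ 2 ∈ H` contains an element with trivial square. -/
theorem exists_mul_sq_eq_one {n : ℕ} (hn : 2 ≤ n) (hev : Even n) {H : Set Γ} {x y α : Γ}
    (hx : orderOf x = 4 * n) (hy : y * y = 1) (hyx : y * x * y⁻¹ = x ^ (2 * n - 1 : ℤ))
    (hxH : ∀ i : ℤ, x ^ i ∈ H ∧ x ^ i * y ∈ H)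
    (hH : ∀ h ∈ H, ∃ i : ℤ, h = x ^ i ∨ h = x ^ i * y)
    (hα : ∀ h ∈ H, α * h * α⁻¹ ∈ H) (hα2 : α ^ 2 ∈ H) :
    ∃ h ∈ H, (h * α) ^ 2 = 1 := by
  have hdvd : ∀ i j : ℤ, x ^ i = x ^ j ↔ (4 * n : ℤ) ∣ j - i := by
    intro i j
    rw [zpow_eq_zpow_iff_modEq, hx, Int.modEq_iff_dvd]
    push_cast
    rfl
  have hone : ∀ i : ℤ, x ^ i = 1 ↔ (4 * n : ℤ) ∣ i := by
    intro i
    rw [← orderOf_dvd_iff_zpow_eq_one, hx]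
    push_cast
    rfl
  have hyi := mul_zpow_eq_of_conj hyx
  have hsq : ∀ i : ℤ, (x ^ i * y) * (x ^ i * y) = x ^ (2 * n * i) := by
    intro i
    rw [mul_assoc, ← mul_assoc y, hyi, mul_assoc (x ^ _), hy, mul_one, ← zpow_add]
    congr 1
    ring
  have hcomm : ¬ Commute y x := by
    intro h
    have h1 : x ^ (1 : ℤ) = x ^ (2 * n - 1 : ℤ) := by
      rw [← hyx, zpow_one, h.eq, mul_inv_cancel_right]
    rw [hdvd] at h1
    have := Int.le_of_dvd (by omega) h1
    omega
  obtain ⟨u, hu⟩ : ∃ u : ℤ, α * x * α⁻¹ = x ^ u := by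
    have h1 := hα x (by simpa using (hxH 1).1)
    obtain ⟨u, h | h⟩ := hH _ h1
    · exact ⟨u, h⟩
    -- Fourth powers of `x ^ u * y` are trivial, whereas `x` has order `4n ≥ 8`.
    · exfalso
      have h2 : α * (x ^ (4 : ℤ)) * α⁻¹ = 1 := by
        rw [← conj_zpow, h, show (4 : ℤ) = 2 * 2 by norm_num, zpow_mul, zpow_two (x ^ u * y), hsq,
          ← zpow_mul, hone]
        exact ⟨u, by ring⟩
      rw [conj_eq_one_iff, hone] at h2
      have := Int.le_of_dvd (by norm_num) h2
      omega
  obtain ⟨l, hl⟩ : ∃ l : ℤ, α * y * α⁻¹ = x ^ l * y := by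
    have h1 := hα y (by simpa using (hxH 0).2)
    obtain ⟨l, h | h⟩ := hH _ h1
    · exfalso
      apply hcomm
      have h2 : Commute (α * y * α⁻¹) (α * x * α⁻¹) := by
        rw [h, hu]
        exact (Commute.refl x).zpow_zpow l u
      exact (Commute.conj_iff α).1 h2
    · exact ⟨l, h⟩
  have hαi := mul_zpow_eq_of_conj hu
  have hαy : α * y = x ^ l * y * α := by rw [← hl, inv_mul_cancel_right]
  -- `l` is even because the conjugate `x ^ l * y` of `y` has trivial square `x ^ (2nl)`.
  obtain ⟨k, rfl⟩ : ∃ k : ℤ, l = 2 * k := by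
    have h1 : x ^ (2 * n * l) = 1 := by
      rw [← hsq, ← hl, conj_mul, hy, mul_one, mul_inv_cancel]
    rw [hone] at h1
    obtain ⟨k, hk⟩ := h1
    refine ⟨k, ?_⟩
    have h2 : (2 * n : ℤ) ≠ 0 := by omega
    apply mul_left_cancel₀ h2
    linear_combination hk
  have hα2x : α ^ 2 * x = x ^ (u * u) * α ^ 2 := by
    have := hαi 1
    rw [zpow_one, mul_one] at this
    rw [sq, mul_assoc, this, ← mul_assoc, hαi, mul_assoc]
  have hα2y : α ^ 2 * y = x ^ (u * (2 * k) + 2 * k) * y * α ^ 2 := by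
    rw [sq, mul_assoc, hαy, mul_assoc (x ^ _), ← mul_assoc α, hαi, mul_assoc (x ^ _), ← mul_assoc α,
      hαy, zpow_add]
    simp only [mul_assoc]
  obtain ⟨m, hm | hm⟩ := hH _ hα2
  · have hu2 : (4 * n : ℤ) ∣ u ^ 2 - 1 := by
      have h1 : x ^ (1 : ℤ) = x ^ (u * u) := by
        rw [zpow_one]
        apply mul_right_cancel (b := α ^ 2)
        rw [← hα2x, hm]
        exact ((Commute.refl x).zpow_right m).eq
      rw [hdvd] at h1
      rwa [sq]
    -- Compare two computations of `α ^ 2 * y`.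
    have hkm : (4 * n : ℤ) ∣ 2 * k * (u + 1) - m * (2 - 2 * n) := by
      have h1 : x ^ m = x ^ (u * (2 * k) + 2 * k + (2 * n - 1) * m) := by
        apply mul_right_cancel (b := y)
        rw [hm, mul_assoc _ y, hyi, ← mul_assoc, ← zpow_add] at hα2y
        exact hα2y
      rw [hdvd] at h1
      convert h1 using 1
      ring
    obtain ⟨a, ha | ha⟩ := exists_involution_exponent (by exact_mod_cast hev) hu2 hkm
    · refine ⟨x ^ a, (hxH a).1, ?_⟩
      rw [sq, mul_assoc, ← mul_assoc α, hαi, mul_assoc (x ^ _), ← sq, hm, ← zpow_add, ← zpow_add,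
        hone]
      convert ha using 1
      ring
    · refine ⟨x ^ a * y, (hxH a).2, ?_⟩
      have h1 : (x ^ a * y * α) ^ 2 = x ^ a * (y * x ^ (u * a + 2 * k)) * y * α ^ 2 := by
        have h2 : α * (x ^ a * y * α) = x ^ (u * a + 2 * k) * y * α ^ 2 := by
          rw [mul_assoc (x ^ a), ← mul_assoc α, hαi, mul_assoc (x ^ _), ← mul_assoc α, hαy, zpow_add,
            sq]
          simp only [mul_assoc]
        rw [sq, mul_assoc (x ^ a * y), h2]
        simp only [mul_assoc]
      rw [h1, hyi, mul_assoc (x ^ a), mul_assoc (x ^ _) y y, hy, mul_one, hm, ← zpow_add,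
        ← zpow_add, hone]
      exact ha
  -- If `α ^ 2 = x ^ m * y`, then `u² ≡ 2n - 1` mod `4n`; but `2n - 1 ≡ 3` mod 4 for even `n`, not a
  -- square.
  · exfalso
    have h1 : x ^ (2 * n - 1 : ℤ) = x ^ (u * u) := by
      apply mul_right_cancel (b := α ^ 2)
      rw [← hα2x, hm, mul_assoc _ y x]
      have := hyi 1
      rw [zpow_one, mul_one] at this
      rw [this, ← mul_assoc, ← mul_assoc, ← zpow_add, ← zpow_add, add_comm]
    rw [hdvd] at h1
    obtain ⟨q, hq⟩ := h1
    obtain ⟨N, rfl⟩ := hev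
    push_cast at hq
    rcases Int.even_or_odd' u with ⟨v, rfl | rfl⟩
    · have : 4 * (v * v) - 4 * N + 1 = 8 * (N * q) := by linear_combination hq
      omega
    · have : 4 * (v * v + v) + 2 - 4 * N = 8 * (N * q) := by linear_combination hq
      omega

/-- Every extension of `G n`, `n` even, by a cyclic group of order two has an element with trivial
square in the nontrivial coset. -/
theorem exists_mem_mul_sq_eq_one {n : ℕ} (hn : 2 ≤ n) (hev : Even n) {H : Subgroup Γ}
    (e : H ≃* G n) {α : Γ} (hα : α ∈ Subgroup.normalizer (H : Set Γ)) (hα2 : α ^ 2 ∈ H) :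
    ∃ h ∈ H, (h * α) ^ 2 = 1 := by
  have : NeZero (4 * n) := ⟨by omega⟩
  let φ : G n →* Γ := H.subtype.comp e.symm.toMonoidHom
  have hφ : Function.Injective φ := H.subtype_injective.comp e.symm.injective
  let a : G n := SemidirectProduct.inl (Multiplicative.ofAdd 1)
  let b : G n := SemidirectProduct.inr (Multiplicative.ofAdd 1)
  have ha : ∀ i : ℤ, a ^ i = SemidirectProduct.inl (Multiplicative.ofAdd (i : ZMod (4 * n))) := by
    intro i
    rw [← map_zpow, ← ofAdd_zsmul, zsmul_one]
  have hb : b * b = 1 := by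
    rw [← map_mul, ← map_one (SemidirectProduct.inr)]
    congr 1
  have hba : b * a * b⁻¹ = a ^ (2 * n - 1 : ℤ) := by
    rw [ha]
    have h1 : b * a * b⁻¹ = SemidirectProduct.inl (action n (Multiplicative.ofAdd 1)
        (Multiplicative.ofAdd 1)) := by
      rw [SemidirectProduct.inl_aut, map_inv]
    rw [h1]
    congr 1
    have h2 : action n (Multiplicative.ofAdd 1) = twist n := by
      change (if Multiplicative.ofAdd (1 : ZMod 2) = 1 then 1 else twist n) = twist n
      exact if_neg (by decide)
    rw [h2]
    change Multiplicative.ofAdd ((2 * (n : ZMod (4 * n)) - 1) * 1) = _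
    push_cast
    rw [mul_one]
  have hmem : ∀ g : G n, φ g ∈ H := fun g => (e.symm g).2
  refine exists_mul_sq_eq_one (H := H) (x := φ a) (y := φ b) hn hev ?_ ?_ ?_ ?_ ?_ ?_ hα2
  · rw [orderOf_injective φ hφ, orderOf_injective _ SemidirectProduct.inl_injective,
      orderOf_ofAdd_eq_addOrderOf, ZMod.addOrderOf_one]
  · rw [← map_mul, hb, map_one]
  · rw [← map_inv, ← map_mul, ← map_mul, hba, map_zpow]
  · intro i
    rw [← map_zpow, ← map_mul]
    exact ⟨hmem _, hmem _⟩
  · intro h hh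
    obtain ⟨g, rfl⟩ : ∃ g, φ g = h := ⟨e ⟨h, hh⟩, by simp [φ]⟩
    obtain ⟨i, hi⟩ := ZMod.intCast_surjective (Multiplicative.toAdd g.left)
    have hg : g = a ^ i * SemidirectProduct.inr g.right := by
      rw [ha, hi]
      exact (SemidirectProduct.inl_left_mul_inr_right g).symm
    have key : ∀ c : Multiplicative (ZMod 2), c = 1 ∨ c = Multiplicative.ofAdd 1 := by decide
    refine ⟨i, ?_⟩
    rcases key g.right with h | h
    · left
      rw [hg, h, map_one, mul_one, map_zpow]
    · right
      rw [hg, h, map_mul, map_zpow]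
  · intro h hh
    exact (Subgroup.mem_normalizer_iff.1 hα h).1 hh

end QuasiDihedral

/-! ### Conformal versus anticonformal maps -/

namespace RiemannSurface

variable {S : Type*} [TopologicalSpace S] [ChartedSpace ℂ S]

/-- The real derivative of conjugation is conjugation itself, which does not commute with
multiplication by `I`. -/
theorem not_differentiableAt_conj (z : ℂ) : ¬ DifferentiableAt ℂ (conj : ℂ → ℂ) z := by
  intro h
  have h1 := (h.hasFDerivAt.restrictScalars ℝ).unique Complex.conjCLE.hasFDerivAt
  have h2 : fderiv ℂ conj z 1 = 1 := by simpa using DFunLike.congr_fun h1 1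
  have h3 : fderiv ℂ conj z Complex.I = -Complex.I := by simpa using DFunLike.congr_fun h1 Complex.I
  have h4 : fderiv ℂ conj z Complex.I = Complex.I := by
    simpa [h2] using (fderiv ℂ conj z).map_smul Complex.I 1
  exact Complex.I_ne_zero (self_eq_neg.1 (h4.symm.trans h3))

theorem not_isAntiholomorphic_id [Nonempty S] : ¬ IsAntiholomorphic (id : S → S) := by
  rintro ⟨-, h⟩
  obtain ⟨p⟩ := ‹Nonempty S›
  exact not_differentiableAt_conj _
    ((h p).congr_of_eventuallyEq ((localRep_id p).fun_comp conj).symm)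

/-- Otherwise `f.symm ∘ f = id` would be antiholomorphic. -/
theorem IsAnticonformal.notMem_autPlus [Nonempty S] {f : S ≃ₜ S} (hf : IsAnticonformal f) :
    f ∉ AutPlus S := by
  intro h
  have h1 : IsAntiholomorphic (f.symm ∘ f) := h.2.comp_isAntiholomorphic hf.1
  rw [f.symm_comp_self] at h1
  exact not_isAntiholomorphic_id h1

theorem IsAnticonformal.sq_mem_autPlus {f : S ≃ₜ S} (hf : IsAnticonformal f) :
    f ^ 2 ∈ AutPlus S := by
  rw [sq]
  exact ⟨hf.1.comp hf.1, hf.2.comp hf.2⟩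

theorem IsAnticonformal.conj_mem_autPlus {f g : S ≃ₜ S} (hf : IsAnticonformal f)
    (hg : g ∈ AutPlus S) : f * g * f⁻¹ ∈ AutPlus S :=
  ⟨(hf.1.comp_isHolomorphic hg.1).comp hf.2, hf.1.comp (hg.2.comp_isAntiholomorphic hf.2)⟩

theorem IsAnticonformal.mem_normalizer_autPlus {f : S ≃ₜ S} (hf : IsAnticonformal f) :
    f ∈ Subgroup.normalizer (AutPlus S : Set (S ≃ₜ S)) := by
  refine Subgroup.mem_normalizer_iff.2 fun g => ⟨hf.conj_mem_autPlus, fun h => ?_⟩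
  have hf' : IsAnticonformal f⁻¹ := ⟨hf.2, hf.1⟩
  have := hf'.conj_mem_autPlus h
  simpa [mul_assoc] using this

end RiemannSurface

theorem theorem5p10 (n : ℕ) (hn : 2 ≤ n) (hev : Even n)
    (S : Type*) [TopologicalSpace S] [T2Space S] [CompactSpace S] [ConnectedSpace S]
    [ChartedSpace ℂ S] [IsManifold 𝓘(ℂ) ω S] (hS : RiemannSurface.IsPseudoReal S) :
    (¬ ∃ H : Subgroup (S ≃ₜ S), H ≤ RiemannSurface.AutPlus S ∧
        Nonempty (H ≃* QuasiDihedral.G n) ∧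
        ∃ α ∈ RiemannSurface.Aut S, α ∉ RiemannSurface.AutPlus S ∧
          α ∈ Subgroup.normalizer (H : Set (S ≃ₜ S)) ∧ α ^ 2 ∈ H) ∧
    ¬ Nonempty (RiemannSurface.AutPlus S ≃* QuasiDihedral.G n) := by
  have main : ¬ ∃ H : Subgroup (S ≃ₜ S), H ≤ RiemannSurface.AutPlus S ∧
      Nonempty (H ≃* QuasiDihedral.G n) ∧
      ∃ α ∈ RiemannSurface.Aut S, α ∉ RiemannSurface.AutPlus S ∧
        α ∈ Subgroup.normalizer (H : Set (S ≃ₜ S)) ∧ α ^ 2 ∈ H := by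
    rintro ⟨H, hH, ⟨e⟩, α, hα, hα', hnorm, hα2⟩
    obtain ⟨h, hh, hsq⟩ := QuasiDihedral.exists_mem_mul_sq_eq_one hn hev e hnorm hα2
    have hnot : h * α ∉ RiemannSurface.AutPlus S := fun hm =>
      hα' ((Subgroup.mul_mem_cancel_left _ (hH hh)).1 hm)
    have hanti : RiemannSurface.IsAnticonformal (h * α) :=
      ((RiemannSurface.Aut S).mul_mem (Or.inl (hH hh)) hα).resolve_left hnot
    -- Order exactly two: `h * α` lies outside `AutPlus S`, so it is not the identity.
    exact hS.2 _ hanti (orderOf_eq_prime hsq fun h1 => hnot (h1 ▸ one_mem _))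
  refine ⟨main, fun ⟨e⟩ => ?_⟩
  obtain ⟨f, hf⟩ := hS.1
  exact main ⟨_, le_rfl, ⟨e⟩, f, Or.inr hf, hf.notMem_autPlus, hf.mem_normalizer_autPlus,
    hf.sq_mem_autPlus⟩
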